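/- Let $k$ be a field and let $\mathcal C$ be a semisimple $k$-linear monoidal category: an abelian $k$-linear category with finite-dimensional morphism spaces and a monoidal structure whose tensor product is $k$-bilinear, such that every object is a finite direct sum of simple objects $S$ with $\operatorname{End}_{\mathcal C}(S)=k$, and such that the unit object $I$ is itself simple with $\operatorname{End}_{\mathcal C}(I)=k$. Assume that $\mathcal C$ is (left) rigid: every object $V$ has a dual $V^\vee$ with $\mathrm{ev}\colon V^\vee\otimes V\to I$ and $\mathrm{db}\colon I\to V\otimes V^\vee$ satisfying the usual identities. Put $V^{\otimes 0}=I$, $V^{\otimes (n+1)}=V\otimes V^{\otimes n}$, and let $\Phi^{(n)}\colon V^{\otimes(n-1)}\otimes V\to V^{\otimes n}$ be the canonical isomorphism. A trivial object is a finite direct sum of copies of $I$, and a trivial component $(U^{\mathrm{triv}},\iota,\pi)$ of an object $U$ is the $I$-isotypical component, with its inclusion $\iota\colon U^{\mathrm{triv}}\to U$ and projection $\pi\colon U\to U^{\mathrm{triv}}$, in a decomposition of $U$ as a direct sum of isotypical components. For a trivial object $T=\bigoplus_i I$ with projections $\pi_i$ and injections $\iota_i$, let $\tau=\sum_i(\iota_i\otimes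 V)\circ(V\otimes I\cong I\otimes V)\circ(V\otimes\pi_i)\colon V\otimes T\to T\otimes V$; it is the unique isomorphism natural in $V$ and in the trivial object $T$ which is the canonical one for $T=I$. For an object $V$ and an integer $n\ge 1$ choose a right dual $X$ of $V^{\otimes(n-1)}$, with $\mathrm{db}\colon I\to X\otimes V^{\otimes(n-1)}$ and $\mathrm{ev}\colon V^{\otimes(n-1)}\otimes X\to I$, and a trivial component $((V^{\otimes n})^{\mathrm{triv}},\iota,\pi)$ of $V^{\otimes n}$. The $n$-th Frobenius–Schur endomorphism $\mathrm{FS}^{(n)}_V$ is the composition $$V\xrightarrow{\mathrm{db}\otimes V}(X\otimes V^{\otimes(n-1)})\otimes V\cong X\otimes(V^{\otimes(n-1)}\otimes V)\xrightarrow{X\otimes\Phi^{(n)}}X\otimes V^{\otimes n}\xrightarrow{X\otimes\pi}X\otimes(V^{\otimes n})^{\mathrm{triv}}\xrightarrow{\tau}(V^{\otimes n})^{\mathrm{triv}}\otimes X\xrightarrow{\iota\otimes X}V^{\otimes n}\otimes X\cong V\otimes(V^{\otimes(n-1)}\otimes X)\xrightarrow{V\otimes\mathrm{ev}}V .$$ Then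 for every $n\ge 1$ such choices exist for every object $V$, the endomorphism $\mathrm{FS}^{(n)}_V$ does not depend on them, and the maps $\mathrm{FS}^{(n)}_V\colon V\to V$ form a natural endomorphism of the identity functor of $\mathcal C$: $f\circ\mathrm{FS}^{(n)}_V=\mathrm{FS}^{(n)}_W\circ f$ for all $f\colon V\to W$. -/

import Mathlib

open CategoryTheory CategoryTheory.Limits CategoryTheory.MonoidalCategory

attribute [local instance] CategoryTheory.Abelian.hasFiniteBiproducts

noncomputable section

namespace FrobeniusSchur

universe w v u

/-- `S` is a simple object of the `k`-linear category `C` with `End(S) = k`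
(an absolutely simple object): the map `k → End(S)`, `a ↦ a • id`, is bijective. -/
structure IsSimpleObject (k : Type w) [Field k] {C : Type u} [Category.{v} C] [Abelian C]
    [Linear k C] (S : C) : Prop where
  simple : Simple S
  end_eq : Function.Bijective (fun a : k => a • 𝟙 S)

/-- `T` is isomorphic to a (finite) direct sum of copies of `S`. -/
def IsIsotypical {C : Type u} [Category.{v} C] [Abelian C] (S T : C) : Prop :=
  ∃ r : ℕ, Nonempty (T ≅ ⨁ fun _ : Fin r => S)

/-- A semisimple `k`-linear monoidal category (on top of the abelian, `k`-linear and monoidal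
structures and bilinearity of the tensor product): finite-dimensional morphism spaces, every object
is a direct sum of simple objects, and the unit object is simple. -/
class SemisimpleMonoidal (k : Type w) [Field k] (C : Type u) [Category.{v} C] [Abelian C]
    [Linear k C] [MonoidalCategory C] [MonoidalPreadditive C] [MonoidalLinear k C] : Prop where
  finiteDimensional : ∀ X Y : C, FiniteDimensional k (X ⟶ Y)
  directSum : ∀ V : C, ∃ (r : ℕ) (S : Fin r → C),
    (∀ i, IsSimpleObject k (S i)) ∧ Nonempty (V ≅ ⨁ S)
  unit_simple : IsSimpleObject k (𝟙_ C)

/-- A trivial object: a direct sum of copies of the unit object. -/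
def IsTrivial {C : Type u} [Category.{v} C] [Abelian C] [MonoidalCategory C] (T : C) : Prop :=
  IsIsotypical (𝟙_ C) T

/-- A trivial component `(V^triv, ι, π)` of `V`: the `I`-isotypical component in a decomposition of
`V` into isotypical components. The remaining (finitely many) components `(X j, i j, p j)` are
isotypical for pairwise non-isomorphic simple objects `S j` not isomorphic to `I`; every component
satisfies `π ∘ ι = id`, and the sum of all the `ι ∘ π` is the identity of `V`. -/
structure TrivialComponent (k : Type w) [Field k] {C : Type u} [Category.{v} C] [Abelian C]
    [Linear k C] [MonoidalCategory C] (V : C) where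
  obj : C
  incl : obj ⟶ V
  proj : V ⟶ obj
  isTrivial : IsTrivial obj
  incl_proj : incl ≫ proj = 𝟙 obj
  decomposition : ∃ (m : ℕ) (S X : Fin m → C) (i : ∀ j, X j ⟶ V) (p : ∀ j, V ⟶ X j),
    (∀ j, IsSimpleObject k (S j)) ∧
    (∀ j, IsEmpty (S j ≅ 𝟙_ C)) ∧
    (∀ j j', j ≠ j' → IsEmpty (S j ≅ S j')) ∧
    (∀ j, IsIsotypical (S j) (X j)) ∧
    (∀ j, i j ≫ p j = 𝟙 (X j)) ∧
    proj ≫ incl + ∑ j, p j ≫ i j = 𝟙 V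

section Tau

variable {C : Type u} [Category.{v} C] [Abelian C] [MonoidalCategory C]

/-- The number of summands in a chosen decomposition of a trivial object. -/
def IsTrivial.copies {T : C} (hT : IsTrivial T) : ℕ := Exists.choose hT

/-- A chosen decomposition of a trivial object. -/
def IsTrivial.iso {T : C} (hT : IsTrivial T) : T ≅ ⨁ fun _ : Fin hT.copies => 𝟙_ C :=
  (Exists.choose_spec hT).some

/-- The isomorphism `τ : V ⊗ T ⟶ T ⊗ V` for a trivial object `T`: for a direct sum decomposition of
`T` with projections `πᵢ : T ⟶ I` and injections `ιᵢ : I ⟶ T`, it is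
`∑ᵢ (ιᵢ ⊗ V) ∘ (V ⊗ I ≅ I ⊗ V) ∘ (V ⊗ πᵢ)`. It does not depend on the decomposition, and it is the
unique isomorphism natural in `V` and `T` that is canonical for `T = I`
(`isTrivialBraiding_tau`, `IsTrivialBraiding.eq_tau`). -/
def tau (V : C) {T : C} (hT : IsTrivial T) : V ⊗ T ⟶ T ⊗ V :=
  ∑ i : Fin hT.copies,
    V ◁ (hT.iso.hom ≫ biproduct.π (fun _ : Fin hT.copies => 𝟙_ C) i) ≫
      ((ρ_ V).hom ≫ (λ_ V).inv) ≫
      (biproduct.ι (fun _ : Fin hT.copies => 𝟙_ C) i ≫ hT.iso.inv) ▷ V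

theorem isTrivial_unit : IsTrivial (𝟙_ C) :=
  ⟨1, ⟨(biproductUniqueIso (fun _ : Fin 1 => 𝟙_ C)).symm⟩⟩

/-- `t` is a family of isomorphisms `V ⊗ T ⟶ T ⊗ V`, natural in `V` and in the trivial object `T`,
which for `T = I` is the canonical isomorphism. -/
structure IsTrivialBraiding (t : ∀ (V T : C), IsTrivial T → (V ⊗ T ⟶ T ⊗ V)) : Prop where
  isIso : ∀ (V T : C) (hT : IsTrivial T), IsIso (t V T hT)
  naturality_left : ∀ {V W : C} (f : V ⟶ W) (T : C) (hT : IsTrivial T),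
    f ▷ T ≫ t W T hT = t V T hT ≫ T ◁ f
  naturality_right : ∀ (V : C) {T T' : C} (hT : IsTrivial T) (hT' : IsTrivial T') (g : T ⟶ T'),
    V ◁ g ≫ t V T' hT' = t V T hT ≫ g ▷ V
  unit : ∀ V : C, t V (𝟙_ C) isTrivial_unit = (ρ_ V).hom ≫ (λ_ V).inv

theorem total_of_iso {T : C} {n : ℕ} (e : T ≅ ⨁ fun _ : Fin n => 𝟙_ C) :
    ∑ i, (e.hom ≫ biproduct.π (fun _ : Fin n => 𝟙_ C) i) ≫
      (biproduct.ι (fun _ : Fin n => 𝟙_ C) i ≫ e.inv) = 𝟙 T := by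
  have h : ∀ i, (e.hom ≫ biproduct.π (fun _ : Fin n => 𝟙_ C) i) ≫
      (biproduct.ι (fun _ : Fin n => 𝟙_ C) i ≫ e.inv) =
      e.hom ≫ (biproduct.π (fun _ : Fin n => 𝟙_ C) i ≫
        biproduct.ι (fun _ : Fin n => 𝟙_ C) i) ≫ e.inv := fun i => by
    simp only [Category.assoc]
  simp only [h]
  rw [← Preadditive.comp_sum, ← Preadditive.sum_comp, biproduct.total]
  simp

theorem whiskerLeft_unit_endo (k : Type w) [Field k] [Linear k C] [MonoidalPreadditive C]
    [MonoidalLinear k C] [SemisimpleMonoidal k C] (V : C) (a : 𝟙_ C ⟶ 𝟙_ C) :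
    V ◁ a ≫ ((ρ_ V).hom ≫ (λ_ V).inv) = ((ρ_ V).hom ≫ (λ_ V).inv) ≫ a ▷ V := by
  obtain ⟨c, hc⟩ := (SemisimpleMonoidal.unit_simple (k := k) (C := C)).end_eq.2 a
  simp only at hc
  rw [← hc, MonoidalLinear.whiskerLeft_smul, MonoidalLinear.smul_whiskerRight]
  simp

theorem tau_naturality_right (k : Type w) [Field k] [Linear k C] [MonoidalPreadditive C]
    [MonoidalLinear k C] [SemisimpleMonoidal k C] (V : C) {T T' : C} (hT : IsTrivial T)
    (hT' : IsTrivial T') (g : T ⟶ T') :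
    V ◁ g ≫ tau V hT' = tau V hT ≫ g ▷ V := by
  set e := hT.iso
  set e' := hT'.iso
  have h1 : ∑ i, (e.hom ≫ biproduct.π (fun _ : Fin hT.copies => 𝟙_ C) i) ≫
      (biproduct.ι (fun _ : Fin hT.copies => 𝟙_ C) i ≫ e.inv) = 𝟙 T :=
    total_of_iso e
  have h2 : ∑ i, (e'.hom ≫ biproduct.π (fun _ : Fin hT'.copies => 𝟙_ C) i) ≫
      (biproduct.ι (fun _ : Fin hT'.copies => 𝟙_ C) i ≫ e'.inv) = 𝟙 T' :=
    total_of_iso e'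
  unfold tau
  generalize hp : (fun i => e.hom ≫ biproduct.π (fun _ : Fin hT.copies => 𝟙_ C) i) = p at *
  generalize hq : (fun i => biproduct.ι (fun _ : Fin hT.copies => 𝟙_ C) i ≫ e.inv) = q at *
  generalize hp' : (fun i => e'.hom ≫ biproduct.π (fun _ : Fin hT'.copies => 𝟙_ C) i) = p' at *
  generalize hq' : (fun i => biproduct.ι (fun _ : Fin hT'.copies => 𝟙_ C) i ≫ e'.inv) = q' at *
  replace h1 : ∑ i, p i ≫ q i = 𝟙 T := by rw [← hp, ← hq]; exact h1
  replace h2 : ∑ i, p' i ≫ q' i = 𝟙 T' := by rw [← hp', ← hq']; exact h2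
  have e1 : ∀ i, e.hom ≫ biproduct.π (fun _ : Fin hT.copies => 𝟙_ C) i = p i := congrFun hp
  have e2 : ∀ i, biproduct.ι (fun _ : Fin hT.copies => 𝟙_ C) i ≫ e.inv = q i := congrFun hq
  have e3 : ∀ i, e'.hom ≫ biproduct.π (fun _ : Fin hT'.copies => 𝟙_ C) i = p' i := congrFun hp'
  have e4 : ∀ i, biproduct.ι (fun _ : Fin hT'.copies => 𝟙_ C) i ≫ e'.inv = q' i := congrFun hq'
  change V ◁ g ≫ (∑ j, V ◁ (e'.hom ≫ biproduct.π (fun _ : Fin hT'.copies => 𝟙_ C) j) ≫ _ ≫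
      (biproduct.ι (fun _ : Fin hT'.copies => 𝟙_ C) j ≫ e'.inv) ▷ V) =
    (∑ i, V ◁ (e.hom ≫ biproduct.π (fun _ : Fin hT.copies => 𝟙_ C) i) ≫ _ ≫
      (biproduct.ι (fun _ : Fin hT.copies => 𝟙_ C) i ≫ e.inv) ▷ V) ≫ g ▷ V
  simp only [e1, e2, e3, e4]
  -- both sides equal the double sum over the matrix entries of `g`
  have key : ∀ i j, V ◁ (p i ≫ (q i ≫ g ≫ p' j)) ≫ ((ρ_ V).hom ≫ (λ_ V).inv) ≫ q' j ▷ V =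
      V ◁ p i ≫ ((ρ_ V).hom ≫ (λ_ V).inv) ≫ ((q i ≫ g ≫ p' j) ≫ q' j) ▷ V := by
    intro i j
    rw [MonoidalCategory.whiskerLeft_comp, Category.assoc,
      ← Category.assoc (V ◁ (q i ≫ g ≫ p' j)), whiskerLeft_unit_endo k,
      comp_whiskerRight (q i ≫ g ≫ p' j)]
    simp only [Category.assoc]
  have L : ∀ j, V ◁ g ≫ V ◁ p' j = ∑ i, V ◁ (p i ≫ (q i ≫ g ≫ p' j)) := by
    intro j
    rw [← MonoidalCategory.whiskerLeft_comp, ← whiskerLeft_sum]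
    congr 1
    simp only [← Category.assoc, ← Preadditive.sum_comp, h1]
    simp
  have R : ∀ i, q i ▷ V ≫ g ▷ V = ∑ j, ((q i ≫ g ≫ p' j) ≫ q' j) ▷ V := by
    intro i
    rw [← comp_whiskerRight, ← sum_whiskerRight]
    congr 1
    simp only [Category.assoc, ← Preadditive.comp_sum, h2]
    simp
  calc V ◁ g ≫ ∑ j, V ◁ p' j ≫ ((ρ_ V).hom ≫ (λ_ V).inv) ≫ q' j ▷ V
      = ∑ j, ∑ i, V ◁ (p i ≫ (q i ≫ g ≫ p' j)) ≫ ((ρ_ V).hom ≫ (λ_ V).inv) ≫ q' j ▷ V := by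
        rw [Preadditive.comp_sum]
        refine Finset.sum_congr rfl fun j _ => ?_
        rw [← Category.assoc, L, Preadditive.sum_comp]
    _ = ∑ i, ∑ j, V ◁ p i ≫ ((ρ_ V).hom ≫ (λ_ V).inv) ≫ ((q i ≫ g ≫ p' j) ≫ q' j) ▷ V := by
        rw [Finset.sum_comm]
        exact Finset.sum_congr rfl fun i _ => Finset.sum_congr rfl fun j _ => key i j
    _ = (∑ i, V ◁ p i ≫ ((ρ_ V).hom ≫ (λ_ V).inv) ≫ q i ▷ V) ≫ g ▷ V := by
        rw [Preadditive.sum_comp]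
        refine Finset.sum_congr rfl fun i _ => ?_
        simp only [Category.assoc, R, Preadditive.comp_sum]

theorem tau_naturality_left {V W : C} (f : V ⟶ W) {T : C} (hT : IsTrivial T)
    [MonoidalPreadditive C] : f ▷ T ≫ tau W hT = tau V hT ≫ T ◁ f := by
  unfold tau
  rw [Preadditive.comp_sum, Preadditive.sum_comp]
  refine Finset.sum_congr rfl fun i _ => ?_
  have h : f ▷ 𝟙_ C ≫ (ρ_ W).hom ≫ (λ_ W).inv = ((ρ_ V).hom ≫ (λ_ V).inv) ≫ 𝟙_ C ◁ f := by
    simp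
  rw [← Category.assoc, ← whisker_exchange]
  simp only [Category.assoc]
  rw [← whisker_exchange]
  simpa only [Category.assoc] using congrArg
    (fun x => V ◁ (hT.iso.hom ≫ biproduct.π (fun _ : Fin hT.copies => 𝟙_ C) i) ≫ x ≫
      (biproduct.ι (fun _ : Fin hT.copies => 𝟙_ C) i ≫ hT.iso.inv) ▷ W) h

theorem tau_unit (k : Type w) [Field k] [Linear k C] [MonoidalPreadditive C]
    [MonoidalLinear k C] [SemisimpleMonoidal k C] (V : C) :
    tau V (isTrivial_unit (C := C)) = (ρ_ V).hom ≫ (λ_ V).inv := by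
  set hT := isTrivial_unit (C := C)
  have h1 : ∑ i, (hT.iso.hom ≫ biproduct.π (fun _ : Fin hT.copies => 𝟙_ C) i) ≫
      (biproduct.ι (fun _ : Fin hT.copies => 𝟙_ C) i ≫ hT.iso.inv) = 𝟙 (𝟙_ C) :=
    total_of_iso hT.iso
  unfold tau
  simp only [← whiskerLeft_unit_endo k V (_ ≫ _)]
  simp only [← Category.assoc (V ◁ _) (V ◁ _), ← MonoidalCategory.whiskerLeft_comp]
  rw [← Preadditive.sum_comp, ← whiskerLeft_sum, h1]
  simp

/-- A family natural in the trivial object and canonical at `I` is equal to `τ`. -/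
theorem IsTrivialBraiding.eq_tau [MonoidalPreadditive C]
    {t : ∀ (V T : C), IsTrivial T → (V ⊗ T ⟶ T ⊗ V)} (ht : IsTrivialBraiding t)
    (V T : C) (hT : IsTrivial T) : t V T hT = tau V hT := by
  have h1 : ∑ i, (hT.iso.hom ≫ biproduct.π (fun _ : Fin hT.copies => 𝟙_ C) i) ≫
      (biproduct.ι (fun _ : Fin hT.copies => 𝟙_ C) i ≫ hT.iso.inv) = 𝟙 T :=
    total_of_iso hT.iso
  have h2 : t V T hT = V ◁ (𝟙 T) ≫ t V T hT := by simp
  rw [h2, ← h1, whiskerLeft_sum, Preadditive.sum_comp]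
  unfold tau
  refine Finset.sum_congr rfl fun i _ => ?_
  rw [MonoidalCategory.whiskerLeft_comp, Category.assoc,
    ht.naturality_right V isTrivial_unit hT, ht.unit]

theorem isIso_tau (k : Type w) [Field k] [Linear k C] [MonoidalPreadditive C]
    [MonoidalLinear k C] [SemisimpleMonoidal k C] (V : C) {T : C} (hT : IsTrivial T) :
    IsIso (tau V hT) := by
  set n := hT.copies
  set e : T ≅ ⨁ fun _ : Fin n => 𝟙_ C := hT.iso
  let p : Fin n → (T ⟶ 𝟙_ C) := fun i => e.hom ≫ biproduct.π (fun _ : Fin n => 𝟙_ C) i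
  let q : Fin n → (𝟙_ C ⟶ T) := fun i => biproduct.ι (fun _ : Fin n => 𝟙_ C) i ≫ e.inv
  have h1 : ∑ i, p i ≫ q i = 𝟙 T :=
    total_of_iso e
  have e1 : ∀ i, V ◁ q i ≫ tau V hT = ((ρ_ V).hom ≫ (λ_ V).inv) ≫ q i ▷ V := fun i => by
    rw [tau_naturality_right k V isTrivial_unit hT, tau_unit k]
  have e2 : ∀ i, tau V hT ≫ p i ▷ V = V ◁ p i ≫ ((ρ_ V).hom ≫ (λ_ V).inv) := fun i => by
    rw [← tau_naturality_right k V hT isTrivial_unit, tau_unit k]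
  refine ⟨∑ i, p i ▷ V ≫ ((λ_ V).hom ≫ (ρ_ V).inv) ≫ V ◁ q i, ?_, ?_⟩
  · rw [Preadditive.comp_sum]
    calc _ = ∑ i, V ◁ (p i ≫ q i) := by
          refine Finset.sum_congr rfl fun i _ => ?_
          rw [← Category.assoc, e2]
          simp
      _ = 𝟙 _ := by rw [← whiskerLeft_sum, h1]; simp
  · rw [Preadditive.sum_comp]
    calc _ = ∑ i, (p i ≫ q i) ▷ V := by
          refine Finset.sum_congr rfl fun i _ => ?_
          rw [Category.assoc, Category.assoc, e1]
          simp
      _ = 𝟙 _ := by rw [← sum_whiskerRight, h1]; simp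

/-- `τ` is a natural isomorphism that is canonical at `I`. -/
theorem isTrivialBraiding_tau (k : Type w) [Field k] [Linear k C] [MonoidalPreadditive C]
    [MonoidalLinear k C] [SemisimpleMonoidal k C] :
    IsTrivialBraiding (fun (V T : C) (hT : IsTrivial T) => tau V hT) where
  isIso V _ hT := isIso_tau k V hT
  naturality_left f _ hT := tau_naturality_left f hT
  naturality_right V _ _ hT hT' g := tau_naturality_right k V hT hT' g
  unit V := tau_unit k V

end Tau

/-- The tensor power with rightmost parentheses: `V^{⊗0} = I`, `V^{⊗(n+1)} = V ⊗ V^{⊗n}`. -/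
def tensorPow {C : Type u} [Category.{v} C] [MonoidalCategory C] (V : C) : ℕ → C
  | 0 => 𝟙_ C
  | n + 1 => V ⊗ tensorPow V n

/-- `Φ^{(m+1)} : V^{⊗m} ⊗ V ⟶ V^{⊗(m+1)}`, the canonical reparenthesization. -/
def reassoc {C : Type u} [Category.{v} C] [MonoidalCategory C] (V : C) :
    ∀ m : ℕ, tensorPow V m ⊗ V ⟶ tensorPow V (m + 1)
  | 0 => (λ_ V).hom ≫ (ρ_ V).inv
  | m + 1 => (α_ V (tensorPow V m) V).hom ≫ V ◁ reassoc V m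

/-- The Frobenius-Schur endomorphism `FS_V^{(n)}` with `n = m + 1`, computed with a right dual `X`
of `V^{⊗m}` (that is, with `db : I ⟶ X ⊗ V^{⊗m}` and `ev : V^{⊗m} ⊗ X ⟶ I`) and a trivial
component `T` of `V^{⊗(m+1)}`. -/
def frobeniusSchurEndo {k : Type w} [Field k] {C : Type u} [Category.{v} C] [Abelian C]
    [Linear k C] [MonoidalCategory C] (V : C) (m : ℕ) (X : C) [ExactPairing X (tensorPow V m)]
    (T : TrivialComponent k (tensorPow V (m + 1))) : V ⟶ V :=
  (λ_ V).inv ≫ η_ X (tensorPow V m) ▷ V ≫ (α_ X (tensorPow V m) V).hom ≫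
    X ◁ reassoc V m ≫
    X ◁ T.proj ≫
    tau X T.isTrivial ≫
    T.incl ▷ X ≫
    (α_ V (tensorPow V m) X).hom ≫ V ◁ ε_ X (tensorPow V m) ≫ (ρ_ V).hom

end FrobeniusSchur

end

noncomputable section

namespace FrobeniusSchur

universe w v u

/-! ### Schur's lemma and isotypical decompositions -/

section Schur

variable {k : Type w} [Field k] {C : Type u} [Category.{v} C] [Abelian C] [Linear k C]

/-! By Schur's lemma every morphism respects the splitting of objects into their `I`-isotypical part
and the rest. Hence the middle of the Frobenius–Schur composition is a map `X ⊗ U ⟶ U ⊗ X` natural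
in both variables and independent of the trivial component (`trivialSwap`).

Carrying `A` around a loop through this map turns `G : A ⊗ B ⟶ D ⊗ A` into `B ⟶ D` (`rotation`).
Like a partial trace, this is natural in `B` and `D` and dinatural in `A` (`rotation_dinaturality`);
sliding the identity of `A` shows that the chosen dual is irrelevant. The endomorphism of `V` is the
rotation of the reparenthesization, with `A = V^{⊗m}` and `m = n - 1`.

For `f : V ⟶ W`, applying `f` to the output of the rotation amounts to applying it to the first
tensor factor. Each use of dinaturality changes one factor `V` of `A` into `W` and pushes `f` one
factor further (`rotation_mixed`). After `m` uses `A` is `W^{⊗m}` and `f` acts on the input.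

The loop needs duals on the side opposite to the assumed one. For simple `S`, splitting `I ⟶ S ⊗
S^∨` gives a nonzero map from `S` to its double dual, which is also simple, so `S ≅ S^∨∨` and `S^∨`
is a dual on both sides. Direct sums give the general case (`exists_leftDual`). -/

theorem IsSimpleObject.of_iso {S T : C} (hS : IsSimpleObject k S) (e : T ≅ S) :
    IsSimpleObject k T := by
  have := hS.simple
  refine ⟨Simple.of_iso e, ?_⟩
  have h : (fun a : k => a • 𝟙 T) =
      (fun g : S ⟶ S => e.hom ≫ g ≫ e.inv) ∘ fun a : k => a • 𝟙 S := by
    funext a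
    simp
  rw [h]
  refine Function.Bijective.comp ⟨fun g g' hg => ?_, fun g => ⟨e.inv ≫ g ≫ e.hom, by simp⟩⟩
    hS.end_eq
  simpa using hg

/-- Nonzero objects all of whose endomorphisms are scalars are indecomposable. -/
theorem exists_iso_summand {A : C} (hA : 𝟙 A ≠ 0) (hend : ∀ g : A ⟶ A, ∃ c : k, g = c • 𝟙 A)
    {r : ℕ} {S : Fin r → C} (e : A ≅ ⨁ S) : ∃ i, Nonempty (A ≅ S i) := by
  have htotal : ∑ i, (e.hom ≫ biproduct.π S i) ≫ (biproduct.ι S i ≫ e.inv) = 𝟙 A := by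
    simp only [Category.assoc, ← Preadditive.comp_sum]
    simp only [← Category.assoc (biproduct.π S _), ← Preadditive.sum_comp]
    simp [biproduct.total]
  obtain ⟨i, hi⟩ : ∃ i, (e.hom ≫ biproduct.π S i) ≫ (biproduct.ι S i ≫ e.inv) ≠ 0 := by
    by_contra! h
    exact hA (by rw [← htotal]; simp [h])
  obtain ⟨c, hc⟩ := hend ((e.hom ≫ biproduct.π S i) ≫ (biproduct.ι S i ≫ e.inv))
  have hc0 : c ≠ 0 := by
    rintro rfl
    exact hi (by rw [hc, zero_smul])
  have hr : (biproduct.ι S i ≫ e.inv) ≫ (e.hom ≫ biproduct.π S i) = 𝟙 _ := by simp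
  generalize e.hom ≫ biproduct.π S i = p at *
  generalize biproduct.ι S i ≫ e.inv = q at *
  have hpq : p ≫ (c⁻¹ • q) = 𝟙 A := by
    rw [Linear.comp_smul, hc, smul_smul, inv_mul_cancel₀ hc0, one_smul]
  refine ⟨i, ⟨⟨p, q, ?_, hr⟩⟩⟩
  -- `p ≫ q` is idempotent because `q ≫ p` is the identity, so the nonzero scalar `c` acts as the
  -- identity.
  have : c⁻¹ • q = q := by
    calc c⁻¹ • q = (q ≫ p) ≫ (c⁻¹ • q) := by rw [hr, Category.id_comp]
      _ = q := by rw [Category.assoc, hpq, Category.comp_id]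
  rw [← this, hpq]

/-- A nonzero morphism from a simple object to a direct sum of simple objects is split. -/
theorem exists_retraction {S U : C} (hS : Simple S) {r : ℕ} {R : Fin r → C}
    (hR : ∀ i, Simple (R i)) (e : U ≅ ⨁ R) {g : S ⟶ U} (hg : g ≠ 0) :
    ∃ p : U ⟶ S, g ≫ p = 𝟙 S := by
  obtain ⟨i, hi⟩ : ∃ i, g ≫ e.hom ≫ biproduct.π R i ≠ 0 := by
    by_contra! h
    refine hg ?_
    rw [← cancel_mono e.hom, zero_comp]
    ext i
    simpa using h i
  have := hR i
  have := isIso_of_hom_simple hi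
  refine ⟨(e.hom ≫ biproduct.π R i) ≫ inv (g ≫ e.hom ≫ biproduct.π R i), ?_⟩
  rw [← Category.assoc, IsIso.hom_inv_id]

/-- There are no nonzero morphisms between isotypical objects of different types. -/
theorem IsIsotypical.hom_eq_zero {S S' X X' : C} (hS : Simple S) (hS' : Simple S')
    (hne : IsEmpty (S ≅ S')) (hX : IsIsotypical S X) (hX' : IsIsotypical S' X') (g : X ⟶ X') :
    g = 0 := by
  obtain ⟨r, ⟨e⟩⟩ := hX
  obtain ⟨r', ⟨e'⟩⟩ := hX'
  rw [← cancel_mono e'.hom, ← cancel_epi e.inv]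
  ext j i
  simp only [comp_zero, zero_comp]
  by_contra h
  exact hne.false (@asIso _ _ S S' _ (isIso_of_hom_simple h))

/-- The idempotents that project onto the trivial components are natural. -/
theorem TrivialComponent.proj_incl_naturality [MonoidalCategory C]
    (hI : IsSimpleObject k (𝟙_ C)) {U U' : C} (T : TrivialComponent k U)
    (T' : TrivialComponent k U') (g : U ⟶ U') :
    (T.proj ≫ T.incl) ≫ g = g ≫ T'.proj ≫ T'.incl := by
  obtain ⟨m, S, X, i, p, hS, hSI, -, hX, -, h⟩ := T.decomposition
  obtain ⟨m', S', X', i', p', hS', hSI', -, hX', -, h'⟩ := T'.decomposition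
  -- Both sides of the claim equal the compression of `g` to the trivial components: the
  -- off-diagonal blocks vanish by Schur's lemma.
  have e1 : (T.proj ≫ T.incl) ≫ g = (T.proj ≫ T.incl) ≫ g ≫ T'.proj ≫ T'.incl := by
    conv_lhs => rw [← Category.comp_id g, ← h', Preadditive.comp_add, Preadditive.comp_add]
    simp only [Preadditive.comp_sum, Category.assoc]
    rw [add_eq_left]
    refine Finset.sum_eq_zero fun j _ => ?_
    have : T.incl ≫ g ≫ p' j = 0 := IsIsotypical.hom_eq_zero hI.simple (hS' j).simple
      ⟨fun e => (hSI' j).false e.symm⟩ T.isTrivial (hX' j) _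
    simp [reassoc_of% this]
  have e2 : g ≫ T'.proj ≫ T'.incl = (T.proj ≫ T.incl) ≫ g ≫ T'.proj ≫ T'.incl := by
    conv_lhs => rw [← Category.id_comp (g ≫ _), ← h, Preadditive.add_comp]
    simp only [Preadditive.sum_comp, Category.assoc]
    rw [add_eq_left]
    refine Finset.sum_eq_zero fun j _ => ?_
    have : i j ≫ g ≫ T'.proj = 0 := IsIsotypical.hom_eq_zero (hS j).simple hI.simple
      (hSI j) (hX j) T'.isTrivial _
    simp [reassoc_of% this]
  rw [e1, ← e2]

open scoped Classical in
/-- The `R`-isotypical component of a direct sum. -/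
theorem exists_isotypical_component {V : C} {r : ℕ} {S : Fin r → C} (e : V ≅ ⨁ S) (R : C) :
    ∃ (X : C) (i : X ⟶ V) (p : V ⟶ X), IsIsotypical R X ∧ i ≫ p = 𝟙 X ∧
      p ≫ i = ∑ j, if Nonempty (S j ≅ R) then
        (e.hom ≫ biproduct.π S j) ≫ (biproduct.ι S j ≫ e.inv) else 0 := by
  let P := {j // Nonempty (S j ≅ R)}
  let f : Fin (Fintype.card P) ≃ P := (Fintype.equivFin P).symm
  let φ : ∀ j : P, S j ≅ R := fun j => j.2.some
  refine ⟨⨁ fun _ : Fin (Fintype.card P) => R,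
    biproduct.desc fun a => (φ (f a)).inv ≫ biproduct.ι S (f a) ≫ e.inv,
    biproduct.lift fun a => (e.hom ≫ biproduct.π S (f a)) ≫ (φ (f a)).hom,
    ⟨_, ⟨Iso.refl _⟩⟩, ?_, ?_⟩
  · ext a b
    by_cases hab : b = a
    · subst hab
      simp
    · have : (f b : Fin r) ≠ f a := fun h => hab (f.injective (Subtype.ext h))
      simp [biproduct.ι_π_ne_assoc _ this, biproduct.ι_π_ne _ hab]
  · rw [biproduct.lift_desc, ← Finset.sum_filter,
      Finset.sum_subtype (Finset.univ.filter fun j => Nonempty (S j ≅ R))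
        (p := fun j => Nonempty (S j ≅ R)) (by simp)]
    refine Fintype.sum_equiv f _ _ fun a => ?_
    simp [P]

/-- Trivial components exist. -/
theorem nonempty_trivialComponent [MonoidalCategory C] {V : C} {r : ℕ} {S : Fin r → C}
    (hS : ∀ i, IsSimpleObject k (S i)) (e : V ≅ ⨁ S) : Nonempty (TrivialComponent k V) := by
  classical
  -- Group the summands by isomorphism class. The classes other than that of `I`, each with a
  -- representative, index the remaining components.
  let s : Setoid (Fin r) := (isIsomorphicSetoid C).comap S
  let Q := {q : Quotient s // IsEmpty (S q.out ≅ 𝟙_ C)}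
  have hout : ∀ j : Fin r, Nonempty (S (Quotient.mk s j).out ≅ S j) := fun j =>
    Quotient.mk_out (s := s) j
  let f : Q ≃ Fin (Fintype.card Q) := Fintype.equivFin Q
  let R : Fin (Fintype.card Q) → C := fun a => S (f.symm a).1.out
  choose X i p hX hip hpi using fun R : C => exists_isotypical_component e R
  refine ⟨⟨X (𝟙_ C), i _, p _, hX _, hip _, Fintype.card Q, R, fun a => X (R a), fun a => i _,
    fun a => p _, fun a => hS _, fun a => (f.symm a).2, fun a b hab => ⟨fun h => hab ?_⟩,
    fun a => hX _, fun a => hip _, ?_⟩⟩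
  · refine f.symm.injective (Subtype.ext ?_)
    rw [← Quotient.out_eq (f.symm a).1, ← Quotient.out_eq (f.symm b).1]
    exact Quotient.sound (s := s) ⟨h⟩
  · have htotal : ∑ j, (e.hom ≫ biproduct.π S j) ≫ (biproduct.ι S j ≫ e.inv) = 𝟙 V := by
      simp only [Category.assoc, ← Preadditive.comp_sum]
      simp only [← Category.assoc (biproduct.π S _), ← Preadditive.sum_comp]
      simp [biproduct.total]
    simp only [hpi]
    rw [Finset.sum_comm, ← Finset.sum_add_distrib, ← htotal]
    refine Finset.sum_congr rfl fun j _ => ?_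
    generalize (e.hom ≫ biproduct.π S j) ≫ (biproduct.ι S j ≫ e.inv) = t
    obtain ⟨o⟩ := hout j
    -- The `j`-th summand is counted exactly once: in the trivial component, or in the component of
    -- its own class.
    by_cases hj : Nonempty (S j ≅ 𝟙_ C)
    · rw [if_pos hj, add_eq_left]
      refine Finset.sum_eq_zero fun a _ => if_neg ?_
      rintro ⟨h⟩
      exact (f.symm a).2.false (h.symm ≪≫ hj.some)
    · rw [if_neg hj, zero_add]
      let q : Q := ⟨Quotient.mk s j, ⟨fun h => hj ⟨o.symm ≪≫ h⟩⟩⟩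
      rw [Finset.sum_eq_single (f q), if_pos]
      · exact ⟨o.symm ≪≫ eqToIso (by simp [R, q])⟩
      · refine fun a _ ha => if_neg ?_
        rintro ⟨h⟩
        refine ha ?_
        rw [← Equiv.symm_apply_eq]
        refine Subtype.ext ?_
        rw [← Quotient.out_eq (f.symm a).1]
        exact Quotient.sound (s := s) ⟨h.symm⟩
      · simp

end Schur

/-! ### Existence of duals on the other side -/

section Duals

variable {C : Type u} [Category.{v} C] [MonoidalCategory C]

/-- This is the `(i, j)` term of a zigzag for a direct sum of pairings. The inner injection and
projection meet as `a ≫ q`, so off-diagonal terms vanish and diagonal ones reduce to the zigzag of a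
single summand. -/
theorem exactPairing_whiskerLeft_exchange {X Y X' Y' U W : C} [ExactPairing X Y]
    [ExactPairing X' Y'] (a : X ⟶ U) (b : Y ⟶ W) (p : W ⟶ Y') (q : U ⟶ X') :
    W ◁ (η_ X Y ≫ (a ⊗ₘ b)) ≫ (α_ _ _ _).inv ≫ ((p ⊗ₘ q) ≫ ε_ X' Y') ▷ W =
      p ▷ 𝟙_ C ≫ Y' ◁ η_ X Y ≫ Y' ◁ (a ≫ q) ▷ Y ≫ (α_ _ _ _).inv ≫ ε_ X' Y' ▷ Y ≫
        𝟙_ C ◁ b := by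
  have h : W ◁ (a ⊗ₘ b) ≫ (α_ _ _ _).inv ≫ (p ⊗ₘ q) ▷ W =
      p ▷ (X ⊗ Y) ≫ Y' ◁ (a ≫ q) ▷ Y ≫ (α_ _ _ _).inv ≫ (Y' ⊗ X') ◁ b := by
    calc _ = (p ⊗ₘ ((a ≫ q) ⊗ₘ b)) ≫ (α_ _ _ _).inv := by
          rw [← id_tensorHom, ← tensorHom_id, ← associator_inv_naturality,
            tensorHom_comp_tensorHom_assoc, tensorHom_comp_tensorHom]
          simp
      _ = _ := by
          rw [MonoidalCategory.tensorHom_def, MonoidalCategory.tensorHom_def]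
          simp
  calc _ = (W ◁ η_ X Y ≫ p ▷ (X ⊗ Y)) ≫ Y' ◁ (a ≫ q) ▷ Y ≫ (α_ _ _ _).inv ≫
        (Y' ⊗ X') ◁ b ≫ ε_ X' Y' ▷ W := by
        simp only [MonoidalCategory.whiskerLeft_comp, comp_whiskerRight, Category.assoc] at h ⊢
        rw [reassoc_of% h]
    _ = _ := by
        rw [whisker_exchange, whisker_exchange]
        simp

theorem exactPairing_whiskerRight_exchange {X Y X' Y' U W : C} [ExactPairing X Y]
    [ExactPairing X' Y'] (a : X ⟶ U) (b : Y ⟶ W) (p : W ⟶ Y') (q : U ⟶ X') :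
    (η_ X Y ≫ (a ⊗ₘ b)) ▷ U ≫ (α_ _ _ _).hom ≫ U ◁ ((p ⊗ₘ q) ≫ ε_ X' Y') =
      𝟙_ C ◁ q ≫ η_ X Y ▷ X' ≫ (α_ _ _ _).hom ≫ X ◁ (b ≫ p) ▷ X' ≫ X ◁ ε_ X' Y' ≫
        a ▷ 𝟙_ C := by
  have h : (a ⊗ₘ b) ▷ U ≫ (α_ _ _ _).hom ≫ U ◁ (p ⊗ₘ q) =
      (X ⊗ Y) ◁ q ≫ (α_ _ _ _).hom ≫ X ◁ (b ≫ p) ▷ X' ≫ a ▷ (Y' ⊗ X') := by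
    calc _ = (α_ _ _ _).hom ≫ (a ⊗ₘ ((b ≫ p) ⊗ₘ q)) := by
          rw [← id_tensorHom, ← tensorHom_id, associator_naturality_assoc,
            tensorHom_comp_tensorHom, tensorHom_comp_tensorHom]
          simp
      _ = _ := by
          rw [tensorHom_def', tensorHom_def']
          simp
  calc _ = (η_ X Y ▷ U ≫ (X ⊗ Y) ◁ q) ≫ (α_ _ _ _).hom ≫ X ◁ (b ≫ p) ▷ X' ≫
        a ▷ (Y' ⊗ X') ≫ U ◁ ε_ X' Y' := by
        simp only [MonoidalCategory.whiskerLeft_comp, comp_whiskerRight, Category.assoc] at h ⊢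
        rw [reassoc_of% h]
    _ = _ := by
        rw [← whisker_exchange, ← whisker_exchange]
        simp

section Biproduct

variable [Preadditive C] [HasFiniteBiproducts C] [MonoidalPreadditive C]

/-- The direct sum of exact pairings is an exact pairing. -/
abbrev exactPairingBiproduct {r : ℕ} (X Y : Fin r → C) [∀ i, ExactPairing (X i) (Y i)] :
    ExactPairing (⨁ X) (⨁ Y) where
  coevaluation' := ∑ i, η_ (X i) (Y i) ≫ (biproduct.ι X i ⊗ₘ biproduct.ι Y i)
  evaluation' := ∑ i, (biproduct.π Y i ⊗ₘ biproduct.π X i) ≫ ε_ (X i) (Y i)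
  coevaluation_evaluation' := by
    simp only [whiskerLeft_sum, sum_whiskerRight, Preadditive.comp_sum, Preadditive.sum_comp,
      exactPairing_whiskerLeft_exchange]
    rw [Finset.sum_comm]
    have diag : ∀ i, ∑ j, biproduct.π Y j ▷ 𝟙_ C ≫ Y j ◁ η_ (X i) (Y i) ≫
          Y j ◁ (biproduct.ι X i ≫ biproduct.π X j) ▷ Y i ≫ (α_ _ _ _).inv ≫
          ε_ (X j) (Y j) ▷ Y i ≫ 𝟙_ C ◁ biproduct.ι Y i =
        (ρ_ _).hom ≫ (biproduct.π Y i ≫ biproduct.ι Y i) ≫ (λ_ _).inv := by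
      intro i
      rw [Finset.sum_eq_single i]
      · simp
      · intro j _ hj
        simp [biproduct.ι_π_ne X hj.symm]
      · simp
    simp only [diag, ← Preadditive.comp_sum, ← Preadditive.sum_comp, biproduct.total]
    simp
  evaluation_coevaluation' := by
    simp only [whiskerLeft_sum, sum_whiskerRight, Preadditive.comp_sum, Preadditive.sum_comp,
      exactPairing_whiskerRight_exchange]
    rw [Finset.sum_comm]
    have diag : ∀ i, ∑ j, 𝟙_ C ◁ biproduct.π X j ≫ η_ (X i) (Y i) ▷ X j ≫ (α_ _ _ _).hom ≫
          X i ◁ (biproduct.ι Y i ≫ biproduct.π Y j) ▷ X j ≫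
          X i ◁ ε_ (X j) (Y j) ≫ biproduct.ι X i ▷ 𝟙_ C =
        (λ_ _).hom ≫ (biproduct.π X i ≫ biproduct.ι X i) ≫ (ρ_ _).inv := by
      intro i
      rw [Finset.sum_eq_single i]
      · simp
      · intro j _ hj
        simp [biproduct.ι_π_ne Y hj.symm]
      · simp
    simp only [diag, ← Preadditive.comp_sum, ← Preadditive.sum_comp, biproduct.total]
    simp

end Biproduct

variable {k : Type w} [Field k] [Abelian C] [Linear k C] [MonoidalPreadditive C]
  [MonoidalLinear k C]

theorem ExactPairing.coevaluation_ne_zero {X Y : C} [ExactPairing X Y] (hX : 𝟙 X ≠ 0) :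
    η_ X Y ≠ 0 := by
  intro h
  have := ExactPairing.evaluation_coevaluation X Y
  rw [h] at this
  refine hX ?_
  rw [← cancel_epi (λ_ X).hom, ← cancel_mono (ρ_ X).inv]
  simpa using this.symm

/-- The right dual of a simple object is simple. -/
theorem IsSimpleObject.rightDual [SemisimpleMonoidal k C] {X Y : C} [ExactPairing X Y]
    (hX : IsSimpleObject k X) : IsSimpleObject k Y := by
  -- Both endomorphism sets are identified with `Y ⊗ X ⟶ 𝟙_ C`. Only compatibility with scalars is
  -- needed, not multiplicativity; the image of `𝟙 Y` is therefore treated below as an arbitrary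
  -- nonzero scalar `d`.
  let F : (Y ⟶ Y) ≃ (X ⟶ X) :=
    ((Iso.homToEquiv (λ_ Y).symm).trans (tensorRightHomEquiv Y X Y (𝟙_ C)).symm).trans
      ((tensorLeftHomEquiv X X Y (𝟙_ C)).trans (Iso.homToEquiv (ρ_ X)))
  have hF : ∀ (c : k) (g : Y ⟶ Y), F (c • g) = c • F g := by
    intro c g
    simp [F, tensorRightHomEquiv, tensorLeftHomEquiv]
  have hX1 : 𝟙 X ≠ 0 := by
    have := hX.simple
    exact id_nonzero X
  have hF0 : F 0 = 0 := by simpa using hF 0 0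
  have hY1 : 𝟙 Y ≠ 0 := by
    intro h
    have h0 : ∀ g : Y ⟶ Y, g = 0 := fun g => by rw [← Category.comp_id g, h, comp_zero]
    exact hX1 (by rw [← F.apply_symm_apply (𝟙 X), h0 (F.symm (𝟙 X)), hF0])
  obtain ⟨d, hd⟩ := hX.end_eq.2 (F (𝟙 Y))
  simp only at hd
  have hd0 : d ≠ 0 := by
    rintro rfl
    rw [zero_smul] at hd
    exact hY1 (F.injective (by rw [← hd, hF0]))
  have hend : ∀ g : Y ⟶ Y, ∃ c : k, g = c • 𝟙 Y := by
    intro g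
    obtain ⟨c, hc⟩ := hX.end_eq.2 (F g)
    simp only at hc
    refine ⟨c * d⁻¹, F.injective ?_⟩
    rw [hF, ← hd, ← hc, smul_smul, mul_assoc, inv_mul_cancel₀ hd0, mul_one]
  obtain ⟨r, S, hS, ⟨e⟩⟩ := SemisimpleMonoidal.directSum (k := k) Y
  obtain ⟨i, ⟨e'⟩⟩ := exists_iso_summand hY1 hend e
  exact (hS i).of_iso e'

/-- The right dual of a simple object is also its left dual. -/
theorem IsSimpleObject.nonempty_exactPairing [SemisimpleMonoidal k C] {X Y Z : C}
    [ExactPairing X Y] [ExactPairing Y Z] (hX : IsSimpleObject k X) :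
    Nonempty (ExactPairing Y X) := by
  have hZ : IsSimpleObject k Z := (hX.rightDual (Y := Y)).rightDual
  have := hX.simple
  have := hZ.simple
  have hI := (SemisimpleMonoidal.unit_simple (k := k) (C := C)).simple
  obtain ⟨r, S, hS, ⟨e⟩⟩ := SemisimpleMonoidal.directSum (k := k) (X ⊗ Y)
  obtain ⟨p, hp⟩ := exists_retraction hI (fun i => (hS i).simple) e
    (ExactPairing.coevaluation_ne_zero (Y := Y) (id_nonzero X))
  -- The transpose of the retraction `p` of the coevaluation; it is nonzero because `p` is, hence an
  -- isomorphism between simple objects.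
  let g : X ⟶ Z := tensorRightHomEquiv X Y Z (𝟙_ C) p ≫ (λ_ Z).hom
  have hg : g ≠ 0 := by
    intro hg
    have h1 : tensorRightHomEquiv X Y Z (𝟙_ C) p = 0 := by
      rw [← cancel_mono (λ_ Z).hom, zero_comp]
      exact hg
    have h2 : p = 0 := by
      rw [← (tensorRightHomEquiv X Y Z (𝟙_ C)).symm_apply_apply p, h1]
      simp [tensorRightHomEquiv]
    rw [h2, comp_zero] at hp
    exact id_nonzero (𝟙_ C) hp.symm
  have := isIso_of_hom_simple hg
  exact ⟨exactPairingCongrRight (asIso g)⟩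

/-- In a semisimple right rigid category, every object has a left dual. -/
theorem exists_leftDual (k : Type w) [Field k] [Linear k C] [MonoidalLinear k C]
    [SemisimpleMonoidal k C] [RightRigidCategory C] (V : C) :
    ∃ X : C, Nonempty (ExactPairing X V) := by
  obtain ⟨r, S, hS, ⟨e⟩⟩ := SemisimpleMonoidal.directSum (k := k) V
  have h : ∀ i, Nonempty (ExactPairing (HasRightDual.rightDual (S i)) (S i)) := fun i =>
    (hS i).nonempty_exactPairing
      (Z := HasRightDual.rightDual (HasRightDual.rightDual (S i)))
  let : ∀ i, ExactPairing (HasRightDual.rightDual (S i)) (S i) := fun i => (h i).some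
  let := exactPairingBiproduct (fun i => HasRightDual.rightDual (S i)) S
  exact ⟨_, ⟨exactPairingCongrRight (X := ⨁ fun i => HasRightDual.rightDual (S i)) e⟩⟩

end Duals

/-! ### Rotation around the trivial component -/

section Rotation

variable (k : Type w) [Field k] {C : Type u} [Category.{v} C] [Abelian C] [Linear k C]
  [MonoidalCategory C] [MonoidalPreadditive C] [MonoidalLinear k C] [SemisimpleMonoidal k C]

instance instNonemptyTrivialComponent (U : C) : Nonempty (TrivialComponent k U) := by
  obtain ⟨r, S, hS, ⟨e⟩⟩ := SemisimpleMonoidal.directSum (k := k) U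
  exact nonempty_trivialComponent hS e

/-- The composition `X ⊗ U ⟶ X ⊗ U^triv ≅ U^triv ⊗ X ⟶ U ⊗ X`. -/
def trivialSwap (X U : C) : X ⊗ U ⟶ U ⊗ X :=
  X ◁ (Classical.arbitrary (TrivialComponent k U)).proj ≫
    tau X (Classical.arbitrary (TrivialComponent k U)).isTrivial ≫
    (Classical.arbitrary (TrivialComponent k U)).incl ▷ X

variable {k} in
-- Since `g` respects the isotypical splitting, it restricts to `T.incl ≫ g ≫ T'.proj` between
-- trivial objects, and `tau` is natural for that map. With `g` the identity this also compares two
-- trivial components of one object.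
theorem TrivialComponent.swap_naturality (X : C) {U U' : C} (T : TrivialComponent k U)
    (T' : TrivialComponent k U') (g : U ⟶ U') :
    X ◁ g ≫ X ◁ T'.proj ≫ tau X T'.isTrivial ≫ T'.incl ▷ X =
      (X ◁ T.proj ≫ tau X T.isTrivial ≫ T.incl ▷ X) ≫ g ▷ X := by
  have hnat := T.proj_incl_naturality SemisimpleMonoidal.unit_simple T' g
  have h1 : g ≫ T'.proj = T.proj ≫ T.incl ≫ g ≫ T'.proj := by
    calc g ≫ T'.proj = (g ≫ T'.proj ≫ T'.incl) ≫ T'.proj := by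
          simp only [Category.assoc, T'.incl_proj, Category.comp_id]
      _ = _ := by rw [← hnat]; simp only [Category.assoc]
  have h2 : (T.incl ≫ g ≫ T'.proj) ≫ T'.incl = T.incl ≫ g := by
    calc (T.incl ≫ g ≫ T'.proj) ≫ T'.incl = T.incl ≫ g ≫ T'.proj ≫ T'.incl := by
          simp only [Category.assoc]
      _ = (T.incl ≫ T.proj) ≫ T.incl ≫ g := by rw [← hnat]; simp only [Category.assoc]
      _ = _ := by rw [T.incl_proj, Category.id_comp]
  rw [← MonoidalCategory.whiskerLeft_comp_assoc, h1, MonoidalCategory.whiskerLeft_comp_assoc,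
    reassoc_of% (tau_naturality_right k X T.isTrivial T'.isTrivial), ← comp_whiskerRight, h2]
  simp only [comp_whiskerRight, Category.assoc]

variable {k} in
theorem TrivialComponent.swap_eq (X : C) {U : C} (T : TrivialComponent k U) :
    X ◁ T.proj ≫ tau X T.isTrivial ≫ T.incl ▷ X = trivialSwap k X U := by
  simpa [trivialSwap] using
    T.swap_naturality X (Classical.arbitrary (TrivialComponent k U)) (𝟙 U) |>.symm

theorem trivialSwap_naturality_right (X : C) {U U' : C} (g : U ⟶ U') :
    X ◁ g ≫ trivialSwap k X U' = trivialSwap k X U ≫ g ▷ X :=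
  TrivialComponent.swap_naturality X _ _ g

theorem trivialSwap_naturality_left {X X' : C} (h : X ⟶ X') (U : C) :
    h ▷ U ≫ trivialSwap k X' U = trivialSwap k X U ≫ U ◁ h := by
  simp only [trivialSwap, Category.assoc]
  rw [← whisker_exchange_assoc, reassoc_of% (tau_naturality_left h), whisker_exchange]

/-- For `G : A ⊗ B ⟶ D ⊗ A`, move a copy of `A` around the trivial component of `D ⊗ A`. -/
def rotation (X A : C) [ExactPairing X A] {B D : C} (G : A ⊗ B ⟶ D ⊗ A) : B ⟶ D :=
  (λ_ B).inv ≫ η_ X A ▷ B ≫ (α_ X A B).hom ≫ X ◁ G ≫ trivialSwap k X (D ⊗ A) ≫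
    (α_ D A X).hom ≫ D ◁ ε_ X A ≫ (ρ_ D).hom

variable {k} in
theorem rotation_eq (X A : C) [ExactPairing X A] {B D : C} (G : A ⊗ B ⟶ D ⊗ A)
    (T : TrivialComponent k (D ⊗ A)) :
    rotation k X A G = (λ_ B).inv ≫ η_ X A ▷ B ≫ (α_ X A B).hom ≫ X ◁ G ≫ X ◁ T.proj ≫
      tau X T.isTrivial ≫ T.incl ▷ X ≫ (α_ D A X).hom ≫ D ◁ ε_ X A ≫ (ρ_ D).hom := by
  rw [rotation, ← T.swap_eq]
  simp only [Category.assoc]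

variable {k} in
theorem frobeniusSchurEndo_eq_rotation (V : C) (m : ℕ) (X : C) [ExactPairing X (tensorPow V m)]
    (T : TrivialComponent k (tensorPow V (m + 1))) :
    frobeniusSchurEndo V m X T = rotation k X (tensorPow V m) (reassoc V m) :=
  (rotation_eq X (tensorPow V m) (reassoc V m) T).symm

theorem rotation_whiskerLeft_comp (X A : C) [ExactPairing X A] {B B' D : C} (f : B ⟶ B')
    (G : A ⊗ B' ⟶ D ⊗ A) : rotation k X A (A ◁ f ≫ G) = f ≫ rotation k X A G := by
  simp only [rotation]
  rw [leftUnitor_inv_naturality_assoc, whisker_exchange_assoc]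
  simp

theorem rotation_comp_whiskerRight (X A : C) [ExactPairing X A] {B D D' : C}
    (G : A ⊗ B ⟶ D ⊗ A) (f : D ⟶ D') :
    rotation k X A (G ≫ f ▷ A) = rotation k X A G ≫ f := by
  simp only [rotation, MonoidalCategory.whiskerLeft_comp, Category.assoc]
  rw [reassoc_of% (trivialSwap_naturality_right k X (f ▷ A)), associator_naturality_left_assoc,
    ← whisker_exchange_assoc, rightUnitor_naturality]

/-- Slide `a` around the loop: through the coevaluation it becomes its mate `h : X' ⟶ X`, which
passes the swap, turns back into `a` at the evaluation, and passes the swap again as `D ◁ a`. -/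
theorem rotation_dinaturality (X A X' A' : C) [ExactPairing X A] [ExactPairing X' A'] {B D : C}
    (a : A ⟶ A') (G : A' ⊗ B ⟶ D ⊗ A) :
    rotation k X A (a ▷ B ≫ G) = rotation k X' A' (G ≫ D ◁ a) := by
  let : HasLeftDual A := ⟨X⟩
  let : HasLeftDual A' := ⟨X'⟩
  obtain ⟨h, h1, h2⟩ : ∃ h : X' ⟶ X, η_ X' A' ≫ h ▷ A' = η_ X A ≫ X ◁ a ∧
      A ◁ h ≫ ε_ X A = a ▷ X' ≫ ε_ X' A' :=
    ⟨leftAdjointMate a, coevaluation_comp_leftAdjointMate a, leftAdjointMate_comp_evaluation a⟩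
  have h1' : η_ X A ▷ B ≫ (α_ X A B).hom ≫ X ◁ a ▷ B =
      η_ X' A' ▷ B ≫ (α_ X' A' B).hom ≫ h ▷ (A' ⊗ B) := by
    have := congrArg (fun t => t ▷ B ≫ (α_ X A' B).hom) h1
    simpa using this.symm
  have h2' : (D ⊗ A) ◁ h ≫ (α_ D A X).hom ≫ D ◁ ε_ X A =
      (D ◁ a) ▷ X' ≫ (α_ D A' X').hom ≫ D ◁ ε_ X' A' := by
    have := congrArg (fun t => (α_ D A X').hom ≫ D ◁ t) h2
    simpa using this
  simp only [rotation, MonoidalCategory.whiskerLeft_comp, Category.assoc]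
  rw [reassoc_of% h1', ← whisker_exchange_assoc, reassoc_of% (trivialSwap_naturality_left k h),
    reassoc_of% h2', reassoc_of% (trivialSwap_naturality_right k X' (D ◁ a))]

end Rotation

/-! ### Mixed tensor powers of `V` and `W` -/

section MixedPower

variable {C : Type u} [Category.{v} C] [MonoidalCategory C]

/-- The tensor product `W ⊗ (⋯ ⊗ (W ⊗ V^{⊗b}))` with `a` factors `W`. -/
def mixedPow (V W : C) : ℕ → ℕ → C
  | 0, b => tensorPow V b
  | a + 1, b => W ⊗ mixedPow V W a b

/-- The canonical map from `(W^{⊗a} ⊗ V^{⊗b}) ⊗ V` to `W^{⊗a} ⊗ V^{⊗(b+1)}`. -/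
def mixedReassoc (V W : C) : ∀ a b : ℕ, mixedPow V W a b ⊗ V ⟶ mixedPow V W a (b + 1)
  | 0, b => reassoc V b
  | a + 1, b => (α_ W (mixedPow V W a b) V).hom ≫ W ◁ mixedReassoc V W a b

/-- Apply `f : V ⟶ W` to the first factor `V` of `W^{⊗a} ⊗ V^{⊗(b+1)}`. -/
def mixedMap {V W : C} (f : V ⟶ W) :
    ∀ a b : ℕ, mixedPow V W a (b + 1) ⟶ W ⊗ mixedPow V W a b
  | 0, b => f ▷ tensorPow V b
  | a + 1, b => W ◁ mixedMap f a b

/-- Applying `f` to the first `V` commutes with absorbing a further `V` at the right end. This puts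
the rotated morphism in the form required by dinaturality. -/
theorem mixedMap_comp_mixedReassoc {V W : C} (f : V ⟶ W) (a b : ℕ) :
    mixedMap f a b ▷ V ≫ mixedReassoc V W (a + 1) b =
      mixedReassoc V W a (b + 1) ≫ mixedMap f a (b + 1) := by
  induction a with
  | zero =>
    change (f ▷ tensorPow V b) ▷ V ≫ (α_ W (tensorPow V b) V).hom ≫ W ◁ reassoc V b =
      ((α_ V (tensorPow V b) V).hom ≫ V ◁ reassoc V b) ≫ f ▷ tensorPow V (b + 1)
    rw [Category.assoc, whisker_exchange]
    simp
  | succ a ih =>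
    change (W ◁ mixedMap f a b) ▷ V ≫ (α_ W (mixedPow V W (a + 1) b) V).hom ≫
        W ◁ mixedReassoc V W (a + 1) b =
      ((α_ W (mixedPow V W a (b + 1)) V).hom ≫ W ◁ mixedReassoc V W a (b + 1)) ≫
        W ◁ mixedMap f a (b + 1)
    rw [Category.assoc, ← MonoidalCategory.whiskerLeft_comp, ← ih]
    exact (associator_naturality_middle_assoc W (mixedMap f a b) V _).trans
      (congrArg _ (MonoidalCategory.whiskerLeft_comp W _ _).symm)

/-- Without factors `V` the mixed power is the tensor power of `W`. -/
def mixedPowIso (V W : C) : ∀ a : ℕ, mixedPow V W a 0 ≅ tensorPow W a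
  | 0 => Iso.refl _
  | a + 1 => whiskerLeftIso W (mixedPowIso V W a)

/-- End of the exchange: with no `V` left in the power, the only `V` for `f` to act on is the
absorbed one. -/
theorem mixedReassoc_comp_mixedMap {V W : C} (f : V ⟶ W) (a : ℕ) :
    (mixedReassoc V W a 0 ≫ mixedMap f a 0) ≫ W ◁ (mixedPowIso V W a).hom =
      (mixedPowIso V W a).hom ▷ V ≫ tensorPow W a ◁ f ≫ reassoc W a := by
  induction a with
  | zero =>
    change (((λ_ V).hom ≫ (ρ_ V).inv) ≫ f ▷ 𝟙_ C) ≫ W ◁ 𝟙 (𝟙_ C) =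
      𝟙 (𝟙_ C) ▷ V ≫ 𝟙_ C ◁ f ≫ (λ_ W).hom ≫ (ρ_ W).inv
    simp
  | succ a ih =>
    change (((α_ W (mixedPow V W a 0) V).hom ≫ W ◁ mixedReassoc V W a 0) ≫
        W ◁ mixedMap f a 0) ≫ W ◁ W ◁ (mixedPowIso V W a).hom =
      (W ◁ (mixedPowIso V W a).hom) ▷ V ≫ (W ⊗ tensorPow W a) ◁ f ≫
        (α_ W (tensorPow W a) W).hom ≫ W ◁ reassoc W a
    simp only [Category.assoc] at ih
    simp only [Category.assoc, ← MonoidalCategory.whiskerLeft_comp]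
    rw [ih]
    have h : ∀ {P Q D : C} (e : P ⟶ Q) (r : Q ⊗ W ⟶ D),
        (α_ W P V).hom ≫ W ◁ (e ▷ V ≫ Q ◁ f ≫ r) =
          (W ◁ e) ▷ V ≫ (W ⊗ Q) ◁ f ≫ (α_ W Q W).hom ≫ W ◁ r := by
      intros
      simp
    exact h _ _

end MixedPower

/-! ### Independence of choices and naturality -/

section Naturality

variable (k : Type w) [Field k] {C : Type u} [Category.{v} C] [Abelian C] [Linear k C]
  [MonoidalCategory C] [MonoidalPreadditive C] [MonoidalLinear k C] [SemisimpleMonoidal k C]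

theorem rotation_independent (X X' A : C) [ExactPairing X A] [ExactPairing X' A] {B D : C}
    (G : A ⊗ B ⟶ D ⊗ A) : rotation k X A G = rotation k X' A G := by
  simpa using rotation_dinaturality k X A X' A (𝟙 A) G

theorem rotation_mixed (hdual : ∀ V : C, ∃ X : C, Nonempty (ExactPairing X V)) {V W : C}
    (f : V ⟶ W) (a b m : ℕ) (h : a + b = m) (X Y : C) [ExactPairing X (mixedPow V W a b)]
    [ExactPairing Y (tensorPow V m)] :
    rotation k X (mixedPow V W a b) (mixedReassoc V W a b ≫ mixedMap f a b) =
      rotation k Y (tensorPow V m) (reassoc V m) ≫ f := by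
  induction a generalizing b X with
  | zero =>
    obtain rfl : b = m := by omega
    let : ExactPairing X (tensorPow V b) := ‹ExactPairing X (mixedPow V W 0 b)›
    exact (rotation_independent k X Y (tensorPow V b) (reassoc V b ≫ f ▷ tensorPow V b)).trans
      (rotation_comp_whiskerRight k Y (tensorPow V b) (reassoc V b) f)
  | succ a ih =>
    -- Sliding `mixedMap f a b` around the loop trades the power with `a` factors `W` for the one
    -- with `a + 1`; the former needs a dual of its own.
    obtain ⟨Z, ⟨_⟩⟩ := hdual (mixedPow V W a (b + 1))
    rw [← ih (b + 1) (by omega) Z]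
    exact (rotation_dinaturality k Z (mixedPow V W a (b + 1)) X (mixedPow V W (a + 1) b)
      (mixedMap f a b) (mixedReassoc V W (a + 1) b)).symm.trans
        (congrArg _ (mixedMap_comp_mixedReassoc f a b))

theorem rotation_reassoc_naturality (hdual : ∀ V : C, ∃ X : C, Nonempty (ExactPairing X V))
    {V W : C} (f : V ⟶ W) (m : ℕ) (X Y : C) [ExactPairing X (tensorPow V m)]
    [ExactPairing Y (tensorPow W m)] :
    f ≫ rotation k Y (tensorPow W m) (reassoc W m) =
      rotation k X (tensorPow V m) (reassoc V m) ≫ f := by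
  obtain ⟨Z, ⟨_⟩⟩ := hdual (mixedPow V W m 0)
  let e := mixedPowIso V W m
  let G : tensorPow W m ⊗ V ⟶ W ⊗ tensorPow W m := tensorPow W m ◁ f ≫ reassoc W m
  have h : mixedReassoc V W m 0 ≫ mixedMap f m 0 = e.hom ▷ V ≫ G ≫ W ◁ e.inv := by
    have h' : (mixedReassoc V W m 0 ≫ mixedMap f m 0) ≫ W ◁ e.hom = e.hom ▷ V ≫ G :=
      mixedReassoc_comp_mixedMap f m
    rw [← Category.assoc, ← h']
    simp
  calc f ≫ rotation k Y (tensorPow W m) (reassoc W m)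
      = rotation k Y (tensorPow W m) G :=
        (rotation_whiskerLeft_comp k Y (tensorPow W m) f (reassoc W m)).symm
    -- Inserting `e.inv` and `e.hom` lets dinaturality along `e.hom` move the loop from `W^{⊗m}` to
    -- the mixed power.
    _ = rotation k Y (tensorPow W m) ((G ≫ W ◁ e.inv) ≫ W ◁ e.hom) := by simp
    _ = rotation k Z (mixedPow V W m 0) (mixedReassoc V W m 0 ≫ mixedMap f m 0) := by
        rw [h, rotation_dinaturality k Z _ Y (tensorPow W m)]
    _ = _ := rotation_mixed k hdual f m 0 m rfl Z X

end Naturality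

end FrobeniusSchur

end

theorem mainTheorem5 {k : Type*} [Field k] {C : Type*} [Category* C] [Abelian C] [Linear k C]
    [MonoidalCategory C] [MonoidalPreadditive C] [MonoidalLinear k C]
    [FrobeniusSchur.SemisimpleMonoidal k C] [RightRigidCategory C] (m : ℕ) :
    (∀ V : C, (∃ X : C, Nonempty (ExactPairing X (FrobeniusSchur.tensorPow V m))) ∧
      Nonempty (FrobeniusSchur.TrivialComponent k (FrobeniusSchur.tensorPow V (m + 1)))) ∧
    ∃! FS : 𝟭 C ⟶ 𝟭 C,
      ∀ (V X : C) [ExactPairing X (FrobeniusSchur.tensorPow V m)]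
        (T : FrobeniusSchur.TrivialComponent k (FrobeniusSchur.tensorPow V (m + 1))),
        FS.app V = FrobeniusSchur.frobeniusSchurEndo V m X T := by
  have hdual := FrobeniusSchur.exists_leftDual (C := C) k
  have hT := FrobeniusSchur.instNonemptyTrivialComponent (C := C) k
  refine ⟨fun V => ⟨hdual _, hT _⟩, ?_⟩
  choose D hD using fun V : C => hdual (FrobeniusSchur.tensorPow V m)
  let P : ∀ V : C, ExactPairing (D V) (FrobeniusSchur.tensorPow V m) := fun V => (hD V).some
  let FS : 𝟭 C ⟶ 𝟭 C :=
    { app := fun V => FrobeniusSchur.rotation k (D V) (FrobeniusSchur.tensorPow V m)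
        (FrobeniusSchur.reassoc V m)
      naturality := fun V W f =>
        FrobeniusSchur.rotation_reassoc_naturality k hdual f m (D V) (D W) }
  -- Uniqueness holds because a dual and a trivial component exist for every `V`, so each value of
  -- `FS'` is prescribed.
  refine ⟨FS, fun V X _ T => ?_, fun FS' h => ?_⟩
  · rw [FrobeniusSchur.frobeniusSchurEndo_eq_rotation]
    exact FrobeniusSchur.rotation_independent k _ _ _ _
  · ext V
    rw [h V (D V) (Classical.choice (hT _)), FrobeniusSchur.frobeniusSchurEndo_eq_rotation]
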